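/- Let $X$ be a Banach space over $\mathbb R$ (a complex Banach space being regarded as a real one), and let $(C(t))_{t\in\mathbb R}$ be a strongly continuous cosine family of bounded linear operators on $X$, i.e. $C(0)=I$, $C(t+s)+C(t-s)=2C(t)C(s)$ for all $s,t\in\mathbb R$, and $t\mapsto C(t)x$ is continuous on $\mathbb R$ for each $x\in X$. Assume that there is a constant $\mathcal K\ge 1$ with $\|C(t)\|\le\mathcal K$ for all $t\in\mathbb R$, and let $S(t)x=\int_0^t C(s)x\,ds$ be the associated sine family. Let $T>0$, let $\psi:[0,T]\to\mathbb R$ be strictly increasing and continuously differentiable with $\psi'(0)\ne 0$, let $1<\alpha\le 2$ and $q=\alpha/2$, and let $$M_q(z)=\sum_{n=0}^{\infty}\frac{(-z)^n}{n!\,\Gamma(1-q(n+1))},\qquad z\ge 0,$$ where $1/\Gamma$ is taken to be $0$ at the poles of $\Gamma$ (so that for $\alpha=2$ all coefficients, and hence $M_1$ and the operators below, vanish). For $0\le s\le t\le T$ and $x\in X$ put $$C_q^\psi(t,0)x=\int_0^\infty M_q(\theta)\,C\big((\psi(t)-\psi(0))^q\theta\big)x\,d\theta,$$ $$R_q^\psi(t,0)x=\int_0^t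 \frac{\psi'(\tau)}{\psi'(0)}\,C_q^\psi(\tau,0)x\,d\tau,$$ $$P_q^\psi(t,s)x=\int_0^\infty q\theta M_q(\theta)\,S\big((\psi(t)-\psi(s))^q\theta\big)x\,d\theta .$$ Then the series and the three integrals converge absolutely, and the operators $C_q^\psi(t,0)$, $R_q^\psi(t,0)$ and $P_q^\psi(t,s)$ are strongly continuous in $t$ in the following sense. For every $u\in X$ and every $\varepsilon>0$ there is a $\delta>0$ such that: 1. $\|C_q^\psi(t_2,0)u-C_q^\psi(t_1,0)u\|<\varepsilon$ whenever $0\le t_1\le t_2\le T$ and $t_2-t_1<\delta$; 2. $\|R_q^\psi(t_2,0)u-R_q^\psi(t_1,0)u\|<\varepsilon$ whenever $0\le t_1\le t_2\le T$ and $t_2-t_1<\delta$; 3. $\|P_q^\psi(t_2,s)u-P_q^\psi(t_1,s)u\|<\varepsilon$ whenever $0\le s\le t_1\le t_2\le T$ and $t_2-t_1<\delta$. -/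

import Mathlib

noncomputable section

namespace PsiFractional

variable {X : Type*} [NormedAddCommGroup X] [NormedSpace ℝ X]

/-- A strongly continuous cosine family `(C(t))_{t ∈ ℝ}` of bounded linear operators on `X`. -/
structure IsCosineFamily (C : ℝ → X →L[ℝ] X) : Prop where
  zero : C 0 = ContinuousLinearMap.id ℝ X
  add_sub : ∀ s t : ℝ, C (t + s) + C (t - s) = (2 : ℝ) • (C t ∘L C s)
  continuous : ∀ x : X, Continuous fun t : ℝ => C t x

/-- The sine family of `C`: `S(t) x = ∫₀ᵗ C(s) x ds`. -/
def sine (C : ℝ → X →L[ℝ] X) (t : ℝ) (x : X) : X :=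
  ∫ s in (0 : ℝ)..t, C s x

/-- The `n`-th term `(-z)^n / (n! Γ(1 - q(n+1)))` of the Mainardi-Wright series. At a pole of `Γ`
one has `Real.Gamma = 0` and hence the term is `0`, which is the usual convention `1/Γ = 0`. -/
def wrightTerm (q z : ℝ) (n : ℕ) : ℝ :=
  (-z) ^ n / ((n.factorial : ℝ) * Real.Gamma (1 - q * ((n : ℝ) + 1)))

/-- Mainardi's Wright-type function `M_q(z) = ∑ₙ (-z)^n / (n! Γ(1 - q(n+1)))`. -/
def wrightM (q z : ℝ) : ℝ :=
  ∑' n : ℕ, wrightTerm q z n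

/-- The integrand `θ ↦ M_q(θ) C((ψ(t) - ψ(0))^q θ) x` of `C_q^ψ(t,0) x`. -/
def cosIntegrand (C : ℝ → X →L[ℝ] X) (ψ : ℝ → ℝ) (q t : ℝ) (x : X) (θ : ℝ) : X :=
  wrightM q θ • C ((ψ t - ψ 0) ^ q * θ) x

/-- `C_q^ψ(t,0) x = ∫₀^∞ M_q(θ) C((ψ(t) - ψ(0))^q θ) x dθ`. -/
def opC (C : ℝ → X →L[ℝ] X) (ψ : ℝ → ℝ) (q t : ℝ) (x : X) : X :=
  ∫ θ in Set.Ioi (0 : ℝ), cosIntegrand C ψ q t x θ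

/-- The integrand `s ↦ (ψ'(s) / ψ'(0)) C_q^ψ(s,0) x` of `R_q^ψ(t,0) x`, where `ψ'` is the derivative
of `ψ` on the interval `[0,T]` (one-sided at the end points). -/
def resIntegrand (C : ℝ → X →L[ℝ] X) (ψ : ℝ → ℝ) (T q : ℝ) (x : X) (s : ℝ) : X :=
  (derivWithin ψ (Set.Icc 0 T) s / derivWithin ψ (Set.Icc 0 T) 0) • opC C ψ q s x

/-- `R_q^ψ(t,0) x = ∫₀ᵗ (ψ'(s) / ψ'(0)) C_q^ψ(s,0) x ds`. -/
def opR (C : ℝ → X →L[ℝ] X) (ψ : ℝ → ℝ) (T q t : ℝ) (x : X) : X :=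
  ∫ s in (0 : ℝ)..t, resIntegrand C ψ T q x s

/-- The integrand `θ ↦ q θ M_q(θ) S((ψ(t) - ψ(s))^q θ) x` of `P_q^ψ(t,s) x`. -/
def sinIntegrand (C : ℝ → X →L[ℝ] X) (ψ : ℝ → ℝ) (q t s : ℝ) (x : X) (θ : ℝ) : X :=
  (q * θ * wrightM q θ) • sine C ((ψ t - ψ s) ^ q * θ) x

/-- `P_q^ψ(t,s) x = ∫₀^∞ q θ M_q(θ) S((ψ(t) - ψ(s))^q θ) x dθ`. -/
def opP (C : ℝ → X →L[ℝ] X) (ψ : ℝ → ℝ) (q t s : ℝ) (x : X) : X :=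
  ∫ θ in Set.Ioi (0 : ℝ), sinIntegrand C ψ q t s x θ

end PsiFractional

end

section

open Real Set Filter Topology MeasureTheory

namespace PsiFractional

/-! Everything reduces to the finiteness of `∫₀^∞ (1 + θ²) |M_q(θ)| dθ`. Since `‖C(r)‖ ≤ K` and
`‖S(r)‖ ≤ K |r|`, this weight dominates the integrands of both `C_q` and `P_q`, and dominated
convergence gives continuity in the scale `r`. Uniform continuity on compact intervals then finishes
the proof.

For `q = 1` the kernel vanishes. For `1/2 < q < 1`, Hankel's integral for `1/Γ` turns the series
into an integral along the ray of angle `φ` (`hasSum_wrightTerm`). If `π/2 < φ < π` and `qφ < π/2`,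
both exponentials in it decay for `z > 0`, so `M_q` is bounded on `z ≥ 0`. The Taylor terms of order
0 and 1 of `exp (e^{iφ} t)` contribute only real numbers, so they drop out of the imaginary part;
the quadratic remainder gives `M_q(z) = O(z^{-(q+2)/q})`, and `(q+2)/q > 3` exactly when `q < 1`. -/

/-! ### Laplace transforms of powers -/

theorem norm_rpow_mul_cexp {t : ℝ} (ht : 0 < t) (p : ℝ) (z : ℂ) :
    ‖((t ^ p : ℝ) : ℂ) * Complex.exp z‖ = t ^ p * Real.exp z.re := by
  rw [norm_mul, Complex.norm_exp, Complex.norm_real, Real.norm_of_nonneg (rpow_nonneg ht.le p)]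

theorem aestronglyMeasurable_rpow_mul_cexp (p : ℝ) {f : ℝ → ℂ} (hf : ContinuousOn f (Ioi 0)) :
    AEStronglyMeasurable (fun t : ℝ => ((t ^ p : ℝ) : ℂ) * Complex.exp (f t))
      (volume.restrict (Ioi 0)) := by
  refine ContinuousOn.aestronglyMeasurable ?_ measurableSet_Ioi
  refine ContinuousOn.mul ?_ (Complex.continuous_exp.comp_continuousOn hf)
  exact Complex.continuous_ofReal.comp_continuousOn
    (continuousOn_id.rpow_const fun t ht => Or.inl (ne_of_gt ht))

theorem integrableOn_rpow_mul_exp_neg {p b : ℝ} (hp : -1 < p) (hb : 0 < b) :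
    IntegrableOn (fun t : ℝ => t ^ p * Real.exp (-(b * t))) (Ioi 0) := by
  simpa using integrableOn_rpow_mul_exp_neg_mul_rpow hp one_pos hb

theorem integrableOn_rpow_mul_cexp_neg {p : ℝ} (hp : -1 < p) {r : ℂ} (hr : 0 < r.re) :
    IntegrableOn (fun t : ℝ => ((t ^ p : ℝ) : ℂ) * Complex.exp (-(r * t))) (Ioi 0) := by
  refine (integrableOn_rpow_mul_exp_neg hp hr).mono'
    (aestronglyMeasurable_rpow_mul_cexp p (by fun_prop)) ?_
  filter_upwards [ae_restrict_mem measurableSet_Ioi] with t ht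
  rw [norm_rpow_mul_cexp ht]
  simp

theorem differentiableAt_integral_rpow_mul_cexp_neg {p : ℝ} (hp : -1 < p) {r : ℂ}
    (hr : 0 < r.re) :
    DifferentiableAt ℂ
      (fun r : ℂ => ∫ t in Ioi (0 : ℝ), ((t ^ p : ℝ) : ℂ) * Complex.exp (-(r * t))) r := by
  -- Halving the real part leaves one exponential that dominates the derivative for all nearby `w`.
  have hs : {w : ℂ | r.re / 2 < w.re} ∈ 𝓝 r :=
    (isOpen_lt continuous_const Complex.continuous_re).mem_nhds (by simp; linarith)
  refine (hasDerivAt_integral_of_dominated_loc_of_deriv_le (μ := volume.restrict (Ioi 0))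
    (F := fun (w : ℂ) (t : ℝ) => ((t ^ p : ℝ) : ℂ) * Complex.exp (-(w * t)))
    (F' := fun (w : ℂ) (t : ℝ) => ((t ^ p : ℝ) : ℂ) * (Complex.exp (-(w * t)) * (-t)))
    (bound := fun t => t ^ (p + 1) * Real.exp (-(r.re / 2 * t))) hs ?_
    (integrableOn_rpow_mul_cexp_neg hp hr) ?_ ?_
    (integrableOn_rpow_mul_exp_neg (by linarith) (by linarith)) ?_).2.differentiableAt
  · exact Eventually.of_forall fun w => aestronglyMeasurable_rpow_mul_cexp p (by fun_prop)
  · have := (aestronglyMeasurable_rpow_mul_cexp p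
      (f := fun t : ℝ => -(r * t)) (by fun_prop)).mul
      (g := fun t : ℝ => -(t : ℂ)) (by fun_prop)
    refine this.congr (Eventually.of_forall fun t => ?_)
    simp only [Pi.mul_apply]
    ring
  · filter_upwards [ae_restrict_mem measurableSet_Ioi] with t ht w hw
    have ht' : (0 : ℝ) < t := ht
    rw [← mul_assoc, norm_mul, norm_rpow_mul_cexp ht, norm_neg, Complex.norm_real,
      Real.norm_of_nonneg ht'.le, rpow_add_one ht'.ne']
    have : Real.exp (-(w * t)).re ≤ Real.exp (-(r.re / 2 * t)) := by
      refine Real.exp_le_exp.2 ?_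
      have : r.re / 2 * t ≤ w.re * t := mul_le_mul_of_nonneg_right (le_of_lt hw) ht'.le
      simpa using this
    calc _ = t ^ p * t * Real.exp (-(w * t)).re := by ring
      _ ≤ _ := by gcongr
  · refine Eventually.of_forall fun t w _ => ?_
    have h1 : HasDerivAt (fun w : ℂ => -(w * t)) (-(t : ℂ)) w := by
      simpa only [one_mul] using! ((hasDerivAt_id w).mul_const (t : ℂ)).neg
    exact h1.cexp.const_mul _

/-- The Laplace transform of `t ^ (s - 1)` on the right half-plane. -/
theorem integral_rpow_mul_cexp_neg {s : ℝ} (hs : 0 < s) {r : ℂ} (hr : 0 < r.re) :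
    ∫ t in Ioi (0 : ℝ), ((t ^ (s - 1) : ℝ) : ℂ) * Complex.exp (-(r * t)) =
      r ^ (-(s : ℂ)) * (Real.Gamma s : ℂ) := by
  have hopen : IsOpen {w : ℂ | 0 < w.re} := isOpen_lt continuous_const Complex.continuous_re
  have h1 : AnalyticOnNhd ℂ
      (fun r : ℂ => ∫ t in Ioi (0 : ℝ), ((t ^ (s - 1) : ℝ) : ℂ) * Complex.exp (-(r * t)))
      {w : ℂ | 0 < w.re} :=
    DifferentiableOn.analyticOnNhd (fun w hw =>
      (differentiableAt_integral_rpow_mul_cexp_neg (by linarith) hw).differentiableWithinAt) hopen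
  have h2 : AnalyticOnNhd ℂ (fun r : ℂ => r ^ (-(s : ℂ)) * (Real.Gamma s : ℂ))
      {w : ℂ | 0 < w.re} := by
    refine DifferentiableOn.analyticOnNhd (fun w hw => ?_) hopen
    refine DifferentiableAt.differentiableWithinAt (DifferentiableAt.mul_const ?_ _)
    exact differentiableAt_id.cpow_const (Or.inl hw)
  have hconn : IsPreconnected {w : ℂ | 0 < w.re} := (convex_halfSpace_re_gt 0).isPreconnected
  -- Identity theorem: both sides are holomorphic on the half-plane and agree at real points
  -- accumulating at 1.
  refine h1.eqOn_of_preconnected_of_frequently_eq h2 hconn (z₀ := 1) (by simp) ?_ hr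
  have ht : Tendsto (fun x : ℝ => (x : ℂ)) (𝓝[≠] 1) (𝓝[≠] 1) := by
    refine tendsto_nhdsWithin_iff.2 ⟨?_, ?_⟩
    · have := (Complex.continuous_ofReal.tendsto (1 : ℝ)).mono_left
        (nhdsWithin_le_nhds (s := {1}ᶜ))
      simpa using this
    · filter_upwards [self_mem_nhdsWithin] with x hx
      simpa using hx
  refine ht.frequently (Eventually.frequently ?_)
  filter_upwards [nhdsWithin_le_nhds (lt_mem_nhds (one_pos : (0 : ℝ) < 1))] with x hx
  have h := Real.integral_rpow_mul_exp_neg_mul_Ioi hs hx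
  rw [one_div, inv_rpow hx.le, ← rpow_neg hx.le] at h
  rw [← Complex.ofReal_neg, ← Complex.ofReal_cpow hx.le, ← Complex.ofReal_mul, ← h,
    ← integral_complex_ofReal]
  congr 1
  ext t
  push_cast
  rfl

/-! ### Hankel integrals for `1/Γ` and for `M_q` -/

theorem exp_re_pos_of_abs_im_lt {L : ℂ} (hL : |L.im| < π / 2) : 0 < (Complex.exp L).re := by
  rw [Complex.exp_re]
  exact mul_pos (Real.exp_pos _) (Real.cos_pos_of_mem_Ioo (abs_lt.1 hL))

theorem integral_rpow_mul_cexp_neg_exp {s : ℝ} (hs : 0 < s) {L : ℂ} (hL : |L.im| < π / 2) :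
    ∫ t in Ioi (0 : ℝ), ((t ^ (s - 1) : ℝ) : ℂ) * Complex.exp (-(Complex.exp L * t)) =
      Complex.exp (-(s * L)) * (Real.Gamma s : ℂ) := by
  rw [integral_rpow_mul_cexp_neg hs (exp_re_pos_of_abs_im_lt hL),
    Complex.cpow_def_of_ne_zero (Complex.exp_ne_zero _), Complex.log_exp]
  · congr 2; ring
  · linarith [(abs_lt.1 hL).1, pi_pos]
  · linarith [(abs_lt.1 hL).2, pi_pos]

/-- Hankel's representation of the reciprocal Gamma function, on a pair of conjugate rays. -/
theorem inv_Gamma_one_sub_eq {s φ : ℝ} (hs : 0 < s) (h1 : π / 2 < φ) (h2 : φ < π) :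
    (Real.Gamma (1 - s))⁻¹ = π⁻¹ * (Complex.exp ((s * φ : ℝ) * Complex.I) *
      ∫ t in Ioi (0 : ℝ), ((t ^ (s - 1) : ℝ) : ℂ) *
        Complex.exp (Complex.exp (φ * Complex.I) * t)).im := by
  -- This `L` has `e^L = -e^{iφ}`. The phases then combine to `e^{iπs}`, whose imaginary part is the
  -- sine in the reflection formula.
  have h := integral_rpow_mul_cexp_neg_exp hs (L := ((φ - π : ℝ) : ℂ) * Complex.I)
    (by simp [abs_lt]; constructor <;> linarith)
  have e : Complex.exp (((φ - π : ℝ) : ℂ) * Complex.I) = -Complex.exp (φ * Complex.I) := by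
    rw [Complex.ofReal_sub, sub_mul, Complex.exp_sub, Complex.exp_pi_mul_I, div_neg,
      div_one]
  simp only [e, neg_mul, neg_neg] at h
  rw [h, ← mul_assoc, ← Complex.exp_add,
    show ((s * φ : ℝ) : ℂ) * Complex.I + -(s * (((φ - π : ℝ) : ℂ) * Complex.I)) =
      ((π * s : ℝ) : ℂ) * Complex.I by push_cast; ring,
    Complex.im_mul_ofReal, Complex.exp_ofReal_mul_I_im]
  -- At a pole of `Γ(1 - s)` the sine vanishes, and division by zero matches the convention `1/Γ =
  -- 0`.
  have hr := Real.Gamma_mul_Gamma_one_sub s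
  have hg := (Real.Gamma_pos_of_pos hs).ne'
  have : (Real.Gamma (1 - s)) = π / Real.sin (π * s) / Real.Gamma s := by
    rw [← hr]; field_simp
  rw [this]
  field_simp

/-- Sublinearity of `t ^ q` for `q < 1`; it lets linear exponential decay absorb `exp (y t ^ q)`. -/
theorem exists_mul_rpow_le_mul_add {q b y : ℝ} (hq0 : 0 < q) (hq1 : q < 1) (hb : 0 < b)
    (hy : 0 ≤ y) : ∃ A : ℝ, ∀ t : ℝ, 0 < t → y * t ^ q ≤ b * t + A := by
  have h : Tendsto (fun t : ℝ => y * t ^ (-(1 - q))) atTop (𝓝 (y * 0)) :=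
    (tendsto_rpow_neg_atTop (by linarith)).const_mul y
  rw [mul_zero] at h
  obtain ⟨a, ha⟩ := eventually_atTop.1 (h.eventually (gt_mem_nhds hb))
  set a' := max a 1
  have ha' : 0 < a' := lt_of_lt_of_le one_pos (le_max_right _ _)
  refine ⟨y * a' ^ q, fun t ht => ?_⟩
  rcases le_total t a' with h' | h'
  · have : y * t ^ q ≤ y * a' ^ q := by gcongr
    nlinarith
  · have h1 := ha t ((le_max_left _ _).trans h')
    have h2 : t ^ q = t ^ (-(1 - q)) * t := by
      rw [← rpow_add_one ht.ne']; congr 1; ring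
    have h3 : y * t ^ (-(1 - q)) * t ≤ b * t := by gcongr
    have h4 : 0 ≤ y * a' ^ q := by positivity
    rw [h2, ← mul_assoc]; linarith

theorem integrableOn_rpow_mul_exp_neg_mul_exp_rpow {p q c y : ℝ} (hp : -1 < p) (hq0 : 0 < q)
    (hq1 : q < 1) (hc : 0 < c) (hy : 0 ≤ y) :
    IntegrableOn (fun t : ℝ => t ^ p * Real.exp (-(c * t)) * Real.exp (y * t ^ q)) (Ioi 0) := by
  obtain ⟨A, hA⟩ := exists_mul_rpow_le_mul_add hq0 hq1 (half_pos hc) hy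
  refine ((integrableOn_rpow_mul_exp_neg hp (half_pos hc)).mul_const (Real.exp A)).mono' ?_ ?_
  · refine ContinuousOn.aestronglyMeasurable ?_ measurableSet_Ioi
    refine ContinuousOn.mul (ContinuousOn.mul ?_ (by fun_prop)) ?_
    · exact continuousOn_id.rpow_const fun t ht => Or.inl (ne_of_gt ht)
    · exact Real.continuous_exp.comp_continuousOn (continuousOn_const.mul
        (continuousOn_id.rpow_const fun t ht => Or.inl (ne_of_gt ht)))
  · filter_upwards [ae_restrict_mem measurableSet_Ioi] with t ht
    have ht' : (0 : ℝ) < t := ht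
    rw [Real.norm_of_nonneg (by positivity), mul_assoc, mul_assoc, ← Real.exp_add, ← Real.exp_add]
    refine mul_le_mul_of_nonneg_left (Real.exp_le_exp.2 ?_) (by positivity)
    linarith [hA t ht]

theorem norm_hankelTerm {q φ z t : ℝ} (ht : 0 < t) (n : ℕ) :
    ‖((t ^ (q * (n + 1) - 1) : ℝ) : ℂ) * Complex.exp (Complex.exp (φ * Complex.I) * t) *
      (((-z) ^ n / n.factorial : ℝ) * Complex.exp ((q * (n + 1) * φ : ℝ) * Complex.I))‖ =
      t ^ (q - 1) * Real.exp (Real.cos φ * t) * ((|z| * t ^ q) ^ n / n.factorial) := by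
  have : t ^ (q * (n + 1) - 1) = t ^ (q - 1) * (t ^ q) ^ n := by
    rw [← rpow_natCast, ← rpow_mul ht.le, ← rpow_add ht]; congr 1; ring
  rw [norm_mul, norm_rpow_mul_cexp ht, norm_mul, Complex.norm_exp_ofReal_mul_I,
    Complex.norm_real, Complex.re_mul_ofReal, Complex.exp_ofReal_mul_I_re, norm_div, norm_pow,
    norm_neg, Real.norm_eq_abs, Real.norm_of_nonneg (Nat.cast_nonneg _), this]
  ring

/-- Hankel's formula with `s = q (n + 1)` is inserted in each coefficient. Sum and integral are
exchanged, and the sum over `n` is an exponential series in `t ^ q`. -/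
theorem hasSum_wrightTerm {q φ : ℝ} (hq0 : 0 < q) (hq1 : q < 1) (h1 : π / 2 < φ) (h2 : φ < π)
    (z : ℝ) :
    HasSum (wrightTerm q z) (π⁻¹ * (∫ t in Ioi (0 : ℝ), ((t ^ (q - 1) : ℝ) : ℂ) *
      Complex.exp (Complex.exp (φ * Complex.I) * t) *
        (Complex.exp ((q * φ : ℝ) * Complex.I) *
          Complex.exp (-(z * Complex.exp ((q * φ : ℝ) * Complex.I) * ((t ^ q : ℝ) : ℂ))))).im) := by
  have hc : 0 < -Real.cos φ := by
    have := Real.cos_neg_of_pi_div_two_lt_of_lt h1 (by linarith [pi_pos])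
    linarith
  set v : ℂ := Complex.exp (φ * Complex.I) with hv
  set a : ℂ := Complex.exp ((q * φ : ℝ) * Complex.I) with ha
  have hr (t : ℝ) : HasSum (fun n : ℕ => t ^ (q - 1) * Real.exp (Real.cos φ * t) *
      ((|z| * t ^ q) ^ n / n.factorial))
      (t ^ (q - 1) * Real.exp (Real.cos φ * t) * Real.exp (|z| * t ^ q)) := by
    have := NormedSpace.expSeries_div_hasSum_exp (|z| * t ^ q)
    rw [← Real.exp_eq_exp_ℝ] at this
    exact this.mul_left _
  have key := hasSum_integral_of_dominated_convergence (μ := volume.restrict (Ioi (0 : ℝ)))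
    (F := fun (n : ℕ) (t : ℝ) => ((t ^ (q * (n + 1) - 1) : ℝ) : ℂ) * Complex.exp (v * t) *
      (((-z) ^ n / n.factorial : ℝ) * Complex.exp ((q * (n + 1) * φ : ℝ) * Complex.I)))
    (f := fun t : ℝ => ((t ^ (q - 1) : ℝ) : ℂ) * Complex.exp (v * t) *
        (a * Complex.exp (-(z * a * ((t ^ q : ℝ) : ℂ)))))
    (fun (n : ℕ) (t : ℝ) => t ^ (q - 1) * Real.exp (Real.cos φ * t) *
      ((|z| * t ^ q) ^ n / n.factorial)) ?_ ?_ ?_ ?_ ?_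
  · have h3 := (Complex.hasSum_im key).mul_left π⁻¹
    refine h3.congr_fun fun n => ?_
    rw [integral_mul_const, wrightTerm, div_mul_eq_div_mul_one_div, one_div,
      inv_Gamma_one_sub_eq (by positivity) h1 h2, mul_left_comm _ ((_ : ℝ) : ℂ),
      Complex.im_ofReal_mul, mul_left_comm, mul_comm (Complex.exp ((q * (n + 1) * φ : ℝ) * _))]
  · exact fun n => (aestronglyMeasurable_rpow_mul_cexp _ (by fun_prop)).mul_const _
  · intro n
    filter_upwards [ae_restrict_mem measurableSet_Ioi] with t ht
    exact (norm_hankelTerm ht n).le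
  · exact Eventually.of_forall fun t => (hr t).summable
  · simp_rw [(hr _).tsum_eq]
    have := integrableOn_rpow_mul_exp_neg_mul_exp_rpow (p := q - 1) (by linarith) hq0 hq1 hc
      (abs_nonneg z)
    simp only [neg_mul, neg_neg] at this
    exact this
  · filter_upwards [ae_restrict_mem measurableSet_Ioi] with t ht
    have ht' : (0 : ℝ) < t := ht
    have := NormedSpace.expSeries_div_hasSum_exp (-(z * a * ((t ^ q : ℝ) : ℂ)))
    rw [← Complex.exp_eq_exp_ℂ] at this
    refine (((this.mul_left a).mul_left
      (((t ^ (q - 1) : ℝ) : ℂ) * Complex.exp (v * t)))).congr_fun fun n => ?_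
    have e1 : t ^ (q * (n + 1) - 1) = t ^ (q - 1) * (t ^ q) ^ n := by
      rw [← rpow_natCast, ← rpow_mul ht'.le, ← rpow_add ht']; congr 1; ring
    have e2 : Complex.exp ((q * (n + 1) * φ : ℝ) * Complex.I) = a * a ^ n := by
      rw [ha, ← Complex.exp_nat_mul, ← Complex.exp_add]; congr 1; push_cast; ring
    rw [e1, e2]
    push_cast
    rw [neg_pow (z : ℂ), neg_pow (_ * _ : ℂ)]
    ring

/-! ### Boundedness and decay of `M_q` -/

theorem integral_rpow_mul_cexp_neg_exp_mul_rpow {p q : ℝ} (hp : -1 < p) (hq : 0 < q) {L : ℂ}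
    (hL : |L.im| < π / 2) :
    ∫ t in Ioi (0 : ℝ), ((t ^ p : ℝ) : ℂ) * Complex.exp (-(Complex.exp L * ((t ^ q : ℝ) : ℂ))) =
      ((q⁻¹ * Real.Gamma ((p + 1) / q) : ℝ) : ℂ) *
        Complex.exp (-(((p + 1) / q : ℝ) * L)) := by
  have hs : 0 < (p + 1) / q := div_pos (by linarith) hq
  have h := integral_comp_rpow_Ioi_of_pos (g := fun y : ℝ => ((y ^ ((p + 1) / q - 1) : ℝ) : ℂ) *
    Complex.exp (-(Complex.exp L * (y : ℂ)))) hq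
  rw [integral_rpow_mul_cexp_neg_exp hs hL] at h
  have e : ∫ t in Ioi (0 : ℝ), (q * t ^ (q - 1)) • (((((t ^ q) ^ ((p + 1) / q - 1) : ℝ) : ℂ)) *
      Complex.exp (-(Complex.exp L * ((t ^ q : ℝ) : ℂ)))) =
      ∫ t in Ioi (0 : ℝ), (q : ℂ) * (((t ^ p : ℝ) : ℂ) *
        Complex.exp (-(Complex.exp L * ((t ^ q : ℝ) : ℂ)))) := by
    refine setIntegral_congr_fun measurableSet_Ioi fun t ht => ?_
    have ht' : (0 : ℝ) < t := ht
    have e1 : t ^ p = t ^ (q - 1) * (t ^ q) ^ ((p + 1) / q - 1) := by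
      rw [← rpow_mul ht'.le, ← rpow_add ht']; congr 1; field_simp; ring
    simp only [Complex.real_smul]
    rw [e1]
    push_cast
    ring
  rw [e, integral_const_mul] at h
  have hq' : (q : ℂ) ≠ 0 := by exact_mod_cast hq.ne'
  apply mul_left_cancel₀ hq'
  rw [h]
  push_cast
  field_simp

theorem norm_exp_sub_one_sub_id_le_of_re_nonpos {w : ℂ} (hw : w.re ≤ 0) :
    ‖Complex.exp w - 1 - w‖ ≤ 3 * ‖w‖ ^ 2 := by
  rcases le_total ‖w‖ 1 with h | h
  · nlinarith [Complex.norm_exp_sub_one_sub_id_le h, sq_nonneg ‖w‖]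
  · have h1 : ‖Complex.exp w‖ ≤ 1 := by
      rw [Complex.norm_exp]; exact Real.exp_le_one_iff.2 hw
    have h2 := norm_sub_le (Complex.exp w - 1) w
    have h3 := norm_sub_le (Complex.exp w) 1
    rw [norm_one] at h3
    nlinarith

/-- The integral has phase `-((q + k)/q) qφ = -(q + k)φ`, which cancels the phase of the prefactor.
This is the contribution of the `k`-th Taylor monomial of `exp (e^{iφ} t)`, up to the real factor
`1/k!`. -/
theorem im_mul_integral_rpow_mul_cexp_eq_zero {q φ z : ℝ} (hq : 0 < q) (hφ : |q * φ| < π / 2)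
    (hz : 0 < z) (k : ℕ) :
    (Complex.exp (φ * Complex.I) ^ k * Complex.exp ((q * φ : ℝ) * Complex.I) *
      ∫ t in Ioi (0 : ℝ), ((t ^ (q - 1 + k) : ℝ) : ℂ) *
        Complex.exp (-(z * Complex.exp ((q * φ : ℝ) * Complex.I) * ((t ^ q : ℝ) : ℂ)))).im = 0 := by
  have hL : Complex.exp ((Real.log z : ℂ) + (q * φ : ℝ) * Complex.I) =
      z * Complex.exp ((q * φ : ℝ) * Complex.I) := by
    rw [Complex.exp_add, ← Complex.ofReal_exp, Real.exp_log hz]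
  have hp : -1 < q - 1 + k := by
    have : (0 : ℝ) ≤ k := k.cast_nonneg
    linarith
  have hq' : (q : ℂ) ≠ 0 := by exact_mod_cast hq.ne'
  rw [← hL, integral_rpow_mul_cexp_neg_exp_mul_rpow hp hq (by simpa using hφ), mul_left_comm,
    ← Complex.exp_nat_mul, ← Complex.exp_add, ← Complex.exp_add, Complex.im_ofReal_mul]
  have : (k : ℂ) * (φ * Complex.I) + (q * φ : ℝ) * Complex.I +
      -((((q - 1 + k + 1) / q : ℝ) : ℂ) * ((Real.log z : ℂ) + (q * φ : ℝ) * Complex.I)) =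
      ((-((q - 1 + k + 1) / q * Real.log z) : ℝ) : ℂ) := by
    push_cast
    field_simp
    ring
  rw [this, ← Complex.ofReal_exp, Complex.ofReal_im, mul_zero]

theorem integrableOn_rpow_mul_cexp_neg_mul_rpow {p q : ℝ} (hp : -1 < p) (hq : 0 < q) {r : ℂ}
    (hr : 0 < r.re) :
    IntegrableOn (fun t : ℝ => ((t ^ p : ℝ) : ℂ) * Complex.exp (-(r * ((t ^ q : ℝ) : ℂ))))
      (Ioi 0) := by
  have hcont : ContinuousOn (fun t : ℝ => -(r * ((t ^ q : ℝ) : ℂ))) (Ioi 0) :=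
    (continuousOn_const.mul (Complex.continuous_ofReal.comp_continuousOn
      (continuousOn_id.rpow_const fun t ht => Or.inl (ne_of_gt ht)))).neg
  refine (integrableOn_rpow_mul_exp_neg_mul_rpow hp hq hr).mono'
    (aestronglyMeasurable_rpow_mul_cexp p hcont) ?_
  filter_upwards [ae_restrict_mem measurableSet_Ioi] with t ht
  rw [norm_rpow_mul_cexp ht, Complex.neg_re, Complex.re_mul_ofReal, neg_mul]

theorem wrightM_eq {q φ : ℝ} (hq0 : 0 < q) (hq1 : q < 1) (h1 : π / 2 < φ) (h2 : φ < π) (z : ℝ) :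
    wrightM q z = π⁻¹ * (∫ t in Ioi (0 : ℝ), ((t ^ (q - 1) : ℝ) : ℂ) *
      Complex.exp (Complex.exp (φ * Complex.I) * t) *
        (Complex.exp ((q * φ : ℝ) * Complex.I) *
          Complex.exp (-(z * Complex.exp ((q * φ : ℝ) * Complex.I) * ((t ^ q : ℝ) : ℂ))))).im :=
  (hasSum_wrightTerm hq0 hq1 h1 h2 z).tsum_eq

theorem cos_neg_of_mem {φ : ℝ} (h1 : π / 2 < φ) (h2 : φ < π) : Real.cos φ < 0 :=
  Real.cos_neg_of_pi_div_two_lt_of_lt h1 (by linarith [pi_pos])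

theorem abs_wrightM_le {q φ : ℝ} (hq0 : 0 < q) (hq1 : q < 1) (h1 : π / 2 < φ) (h2 : φ < π)
    (hφ : |q * φ| < π / 2) {z : ℝ} (hz : 0 ≤ z) :
    |wrightM q z| ≤ π⁻¹ * ∫ t in Ioi (0 : ℝ), t ^ (q - 1) * Real.exp (-(-Real.cos φ * t)) := by
  have hcos : 0 < Real.cos (q * φ) := Real.cos_pos_of_mem_Ioo (abs_lt.1 hφ)
  rw [wrightM_eq hq0 hq1 h1 h2, abs_mul, abs_of_pos (inv_pos.2 pi_pos)]
  refine mul_le_mul_of_nonneg_left ((Complex.abs_im_le_norm _).trans ?_) (inv_pos.2 pi_pos).le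
  refine norm_integral_le_of_norm_le (integrableOn_rpow_mul_exp_neg (by linarith)
    (by linarith [cos_neg_of_mem h1 h2])) ?_
  filter_upwards [ae_restrict_mem measurableSet_Ioi] with t ht
  have ht' : (0 : ℝ) < t := ht
  rw [norm_mul, norm_rpow_mul_cexp ht, norm_mul, Complex.norm_exp_ofReal_mul_I, one_mul,
    Complex.norm_exp, Complex.re_mul_ofReal, Complex.exp_ofReal_mul_I_re, Complex.neg_re,
    Complex.re_mul_ofReal, Complex.re_ofReal_mul, Complex.exp_ofReal_mul_I_re, neg_mul, neg_neg]
  refine mul_le_of_le_one_right (by positivity) (Real.exp_le_one_iff.2 ?_)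
  have : 0 ≤ z * Real.cos (q * φ) * t ^ q := by positivity
  linarith

theorem wrightM_eq_remainder {q φ : ℝ} (hq0 : 0 < q) (hq1 : q < 1) (h1 : π / 2 < φ) (h2 : φ < π)
    (hφ : |q * φ| < π / 2) {z : ℝ} (hz : 0 < z) :
    wrightM q z = π⁻¹ * (∫ t in Ioi (0 : ℝ), ((t ^ (q - 1) : ℝ) : ℂ) *
      (Complex.exp (Complex.exp (φ * Complex.I) * t) - 1 - Complex.exp (φ * Complex.I) * t) *
        (Complex.exp ((q * φ : ℝ) * Complex.I) *
          Complex.exp (-(z * Complex.exp ((q * φ : ℝ) * Complex.I) * ((t ^ q : ℝ) : ℂ))))).im := by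
  have hcos : 0 < Real.cos (q * φ) := Real.cos_pos_of_mem_Ioo (abs_lt.1 hφ)
  rw [wrightM_eq hq0 hq1 h1 h2]
  have hv0 : (Complex.exp (φ * Complex.I)).re ≤ 0 := by
    rw [Complex.exp_ofReal_mul_I_re]; exact (cos_neg_of_mem h1 h2).le
  have hr : 0 < ((z : ℂ) * Complex.exp ((q * φ : ℝ) * Complex.I)).re := by
    rw [Complex.re_ofReal_mul, Complex.exp_ofReal_mul_I_re]; positivity
  have hk := im_mul_integral_rpow_mul_cexp_eq_zero hq0 hφ hz
  set v : ℂ := Complex.exp (φ * Complex.I)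
  set a : ℂ := Complex.exp ((q * φ : ℝ) * Complex.I)
  have hint (k : ℕ) : IntegrableOn (fun t : ℝ => v ^ k * a * (((t ^ (q - 1 + k) : ℝ) : ℂ) *
      Complex.exp (-(z * a * ((t ^ q : ℝ) : ℂ))))) (Ioi 0) :=
    (integrableOn_rpow_mul_cexp_neg_mul_rpow
      (by have : (0 : ℝ) ≤ k := k.cast_nonneg
          linarith) hq0 hr).const_mul _
  have hint0 : IntegrableOn (fun t : ℝ => ((t ^ (q - 1) : ℝ) : ℂ) * Complex.exp (v * t) *
      (a * Complex.exp (-(z * a * ((t ^ q : ℝ) : ℂ))))) (Ioi 0) := by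
    have h := (integrableOn_rpow_mul_cexp_neg_mul_rpow (p := q - 1) (by linarith) hq0
      hr).mul_const a
    refine (h.bdd_mul (c := 1) (f := fun t : ℝ => Complex.exp (v * t)) (by fun_prop) ?_).congr
      (Eventually.of_forall fun t => by simp only; ring)
    filter_upwards [ae_restrict_mem measurableSet_Ioi] with t ht
    rw [Complex.norm_exp, Complex.re_mul_ofReal]
    exact Real.exp_le_one_iff.2 (mul_nonpos_of_nonpos_of_nonneg hv0 (le_of_lt ht))
  have hsub : ∫ t in Ioi (0 : ℝ), ((t ^ (q - 1) : ℝ) : ℂ) * (Complex.exp (v * t) - 1 - v * t) *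
      (a * Complex.exp (-(z * a * ((t ^ q : ℝ) : ℂ)))) =
      (∫ t in Ioi (0 : ℝ), ((t ^ (q - 1) : ℝ) : ℂ) * Complex.exp (v * t) *
        (a * Complex.exp (-(z * a * ((t ^ q : ℝ) : ℂ))))) -
      (v ^ 0 * a * ∫ t in Ioi (0 : ℝ), ((t ^ (q - 1 + (0 : ℕ)) : ℝ) : ℂ) *
        Complex.exp (-(z * a * ((t ^ q : ℝ) : ℂ)))) -
      (v ^ 1 * a * ∫ t in Ioi (0 : ℝ), ((t ^ (q - 1 + (1 : ℕ)) : ℝ) : ℂ) *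
        Complex.exp (-(z * a * ((t ^ q : ℝ) : ℂ)))) := by
    have hs := integral_sub (hint0.sub (hint 0)) (hint 1)
    simp only [Pi.sub_apply] at hs
    rw [← integral_const_mul, ← integral_const_mul, ← integral_sub hint0 (hint 0), ← hs]
    refine setIntegral_congr_fun measurableSet_Ioi fun t ht => ?_
    simp only [Nat.cast_one, Nat.cast_zero, add_zero,
      rpow_add_one (ne_of_gt ht : t ≠ 0)]
    push_cast
    ring
  rw [hsub, Complex.sub_im, Complex.sub_im, hk 0, hk 1, sub_zero, sub_zero]

/-- The quadratic remainder raises `t ^ (q - 1)` to `t ^ (q + 1)`, and scaling `t` by `z ^ (-1/q)`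
yields the power. Removing only the constant term would give `z ^ (-(q + 1)/q)`, too weak for a
second moment when `q > 1/2`. -/
theorem abs_wrightM_le_rpow {q φ : ℝ} (hq0 : 0 < q) (hq1 : q < 1) (h1 : π / 2 < φ) (h2 : φ < π)
    (hφ : |q * φ| < π / 2) : ∃ B : ℝ, ∀ z : ℝ, 0 < z → |wrightM q z| ≤ B * z ^ (-(q + 2) / q) := by
  have hcos : 0 < Real.cos (q * φ) := Real.cos_pos_of_mem_Ioo (abs_lt.1 hφ)
  refine ⟨π⁻¹ * (3 * (Real.cos (q * φ) ^ (-(q + 2) / q) * (1 / q) * Real.Gamma ((q + 2) / q))),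
    fun z hz => ?_⟩
  have hr : 0 < z * Real.cos (q * φ) := by positivity
  have hI := integral_rpow_mul_exp_neg_mul_rpow hq0 (show -1 < q + 1 by linarith) hr
  rw [add_assoc, one_add_one_eq_two, mul_rpow hz.le hcos.le] at hI
  rw [wrightM_eq_remainder hq0 hq1 h1 h2 hφ hz, abs_mul, abs_of_pos (inv_pos.2 pi_pos), mul_assoc]
  refine mul_le_mul_of_nonneg_left ((Complex.abs_im_le_norm _).trans ?_) (inv_pos.2 pi_pos).le
  calc _ ≤ ∫ t in Ioi (0 : ℝ),
        3 * (t ^ (q + 1) * Real.exp (-(z * Real.cos (q * φ)) * t ^ q)) := by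
        refine norm_integral_le_of_norm_le ((integrableOn_rpow_mul_exp_neg_mul_rpow
          (by linarith) hq0 hr).const_mul 3) ?_
        filter_upwards [ae_restrict_mem measurableSet_Ioi] with t ht
        have ht' : (0 : ℝ) < t := ht
        have hw : (Complex.exp (φ * Complex.I) * t).re ≤ 0 := by
          rw [Complex.re_mul_ofReal, Complex.exp_ofReal_mul_I_re]
          exact mul_nonpos_of_nonpos_of_nonneg (cos_neg_of_mem h1 h2).le ht'.le
        have h := norm_exp_sub_one_sub_id_le_of_re_nonpos hw
        have hn : ‖Complex.exp (φ * Complex.I) * t‖ = t := by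
          rw [norm_mul, Complex.norm_exp_ofReal_mul_I, one_mul, Complex.norm_real,
            Real.norm_of_nonneg ht'.le]
        rw [hn] at h
        rw [norm_mul, norm_mul, norm_mul, Complex.norm_exp_ofReal_mul_I, one_mul,
          Complex.norm_real, Real.norm_of_nonneg (by positivity), Complex.norm_exp, Complex.neg_re,
          Complex.re_mul_ofReal, Complex.re_ofReal_mul, Complex.exp_ofReal_mul_I_re,
          show q + 1 = q - 1 + (2 : ℕ) by push_cast; ring, rpow_add_natCast ht'.ne', neg_mul]
        calc _ ≤ t ^ (q - 1) * (3 * t ^ 2) * Real.exp (-(z * Real.cos (q * φ) * t ^ q)) := by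
              gcongr
          _ = _ := by ring
    _ = _ := by rw [integral_const_mul, hI]; ring

theorem exists_hankel_angle {q : ℝ} (hq0 : 1 / 2 < q) (hq1 : q < 1) :
    ∃ φ : ℝ, π / 2 < φ ∧ φ < π ∧ |q * φ| < π / 2 := by
  have hpi := pi_pos
  have hq : 0 < q := by linarith
  have e : q * (π * (1 + q) / (4 * q)) = π * (1 + q) / 4 := by field_simp
  -- The midpoint of `π/2` and `π/(2q)`; the latter is below `π` because `q > 1/2`.
  refine ⟨π * (1 + q) / (4 * q), ?_, ?_, ?_⟩
  · rw [lt_div_iff₀ (by positivity)]; nlinarith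
  · rw [div_lt_iff₀ (by positivity)]; nlinarith
  · rw [e, abs_of_pos (by positivity)]; nlinarith

/-! ### Summability, measurability and moments of `M_q` -/

theorem wrightTerm_one (z : ℝ) (n : ℕ) : wrightTerm 1 z n = 0 := by
  have : Real.Gamma (1 - 1 * ((n : ℝ) + 1)) = 0 := by
    rw [show 1 - 1 * ((n : ℝ) + 1) = -n by ring]
    exact Real.Gamma_neg_nat_eq_zero n
  rw [wrightTerm, this, mul_zero, div_zero]

theorem wrightM_one : wrightM 1 = 0 := by
  ext z
  simp [wrightM, wrightTerm_one]

theorem summable_wrightTerm {q : ℝ} (hq0 : 1 / 2 < q) (hq1 : q ≤ 1) (z : ℝ) :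
    Summable (wrightTerm q z) := by
  rcases hq1.eq_or_lt with rfl | hq1
  · simpa only [funext (wrightTerm_one z)] using summable_zero
  · obtain ⟨φ, h1, h2, -⟩ := exists_hankel_angle hq0 hq1
    exact (hasSum_wrightTerm (by linarith) hq1 h1 h2 z).summable

theorem measurable_wrightM {q : ℝ} (hq0 : 1 / 2 < q) (hq1 : q ≤ 1) : Measurable (wrightM q) := by
  refine measurable_of_tendsto_metrizable
    (f := fun (n : ℕ) (z : ℝ) => ∑ i ∈ Finset.range n, wrightTerm q z i) (fun n => ?_)
    (tendsto_pi_nhds.2 fun z => (summable_wrightTerm hq0 hq1 z).hasSum.tendsto_sum_nat)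
  unfold wrightTerm
  fun_prop

/-- `M_q` has finite absolute moments up to order two on `(0, ∞)`. -/
theorem integrableOn_one_add_sq_mul_abs_wrightM {q : ℝ} (hq0 : 1 / 2 < q) (hq1 : q ≤ 1) :
    IntegrableOn (fun z => (1 + z ^ 2) * |wrightM q z|) (Ioi 0) := by
  have hmeas : Measurable fun z => (1 + z ^ 2) * |wrightM q z| := by
    have := measurable_wrightM hq0 hq1
    fun_prop
  rcases hq1.eq_or_lt with rfl | hq1
  · simp [wrightM_one]
  have hq : 0 < q := by linarith
  obtain ⟨φ, h1, h2, h3⟩ := exists_hankel_angle hq0 hq1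
  -- The uniform bound serves on `(0, 1]`, the power decay on `(1, ∞)`.
  rw [← Ioc_union_Ioi_eq_Ioi zero_le_one]
  refine IntegrableOn.union ?_ ?_
  · refine Measure.integrableOn_of_bounded (M := 2 * (π⁻¹ * ∫ t in Ioi (0 : ℝ),
      t ^ (q - 1) * Real.exp (-(-Real.cos φ * t)))) (by simp) hmeas.aestronglyMeasurable ?_
    filter_upwards [ae_restrict_mem measurableSet_Ioc] with z hz
    rw [Real.norm_of_nonneg (by positivity)]
    exact mul_le_mul (by nlinarith [hz.1, hz.2]) (abs_wrightM_le hq hq1 h1 h2 h3 hz.1.le)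
      (abs_nonneg _) zero_le_two
  · obtain ⟨B, hB⟩ := abs_wrightM_le_rpow hq hq1 h1 h2 h3
    have he : -(q + 2) / q + (2 : ℕ) < -1 := by
      rw [← sub_pos]
      have : -1 - (-(q + 2) / q + (2 : ℕ)) = 2 * (1 - q) / q := by push_cast; field_simp; ring
      rw [this]
      have := sub_pos.2 hq1
      positivity
    refine ((integrableOn_Ioi_rpow_of_lt he one_pos).const_mul (2 * B)).mono'
      hmeas.aestronglyMeasurable ?_
    filter_upwards [ae_restrict_mem measurableSet_Ioi] with z hz
    have hz1 : (1 : ℝ) < z := hz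
    have hz0 : 0 < z := by linarith
    rw [Real.norm_of_nonneg (by positivity), rpow_add_natCast hz0.ne']
    calc _ ≤ (2 * z ^ 2) * (B * z ^ (-(q + 2) / q)) := by
          refine mul_le_mul (by nlinarith) (hB z hz0) (abs_nonneg _) (by positivity)
      _ = _ := by ring

theorem exists_delta_of_continuousOn_Icc {X : Type*} [NormedAddCommGroup X] {f : ℝ → X}
    {a b : ℝ} (hf : ContinuousOn f (Icc a b)) {ε : ℝ} (hε : 0 < ε) : ∃ δ : ℝ, 0 < δ ∧ ∀ x ∈ Icc a b, ∀ y ∈ Icc a b, |y - x| < δ →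
      ‖f y - f x‖ < ε := by
  obtain ⟨δ, hδ, h⟩ := Metric.uniformContinuousOn_iff.1
    (isCompact_Icc.uniformContinuousOn_of_continuous hf) ε hε
  refine ⟨δ, hδ, fun x hx y hy hxy => ?_⟩
  rw [← dist_eq_norm]
  exact h y hy x hx (by rwa [Real.dist_eq])

/-! ### Domination and continuity of the operator integrals -/

section

variable {X : Type*} [NormedAddCommGroup X] [NormedSpace ℝ X]

theorem integrableOn_smul_comp_mul {m b : ℝ → ℝ} {G : ℝ → X} {r : ℝ}
    (hm : Measurable m) (hG : Continuous G) (hb : IntegrableOn b (Ioi 0))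
    (h : ∀ θ : ℝ, 0 < θ → ‖m θ • G (r * θ)‖ ≤ b θ) :
    IntegrableOn (fun θ => m θ • G (r * θ)) (Ioi 0) := by
  refine hb.mono' (hm.aestronglyMeasurable.smul
    (hG.comp (continuous_const_mul r)).aestronglyMeasurable) ?_
  filter_upwards [ae_restrict_mem measurableSet_Ioi] with θ hθ using h θ hθ

theorem continuousOn_integral_smul_comp_mul {m b : ℝ → ℝ} {G : ℝ → X} {S : Set ℝ}
    (hm : Measurable m) (hG : Continuous G) (hb : IntegrableOn b (Ioi 0))
    (h : ∀ r ∈ S, ∀ θ : ℝ, 0 < θ → ‖m θ • G (r * θ)‖ ≤ b θ) :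
    ContinuousOn (fun r => ∫ θ in Ioi (0 : ℝ), m θ • G (r * θ)) S := by
  refine continuousOn_of_dominated (bound := b) (fun r hr => ?_) (fun r hr => ?_) hb
    (Eventually.of_forall fun θ => by fun_prop)
  · exact (integrableOn_smul_comp_mul hm hG hb (h r hr)).aestronglyMeasurable
  · filter_upwards [ae_restrict_mem measurableSet_Ioi] with θ hθ using h r hr θ hθ

variable {C : ℝ → X →L[ℝ] X} {K : ℝ}

theorem norm_apply_le_of_opNorm_le (hCK : ∀ t : ℝ, ‖C t‖ ≤ K) (t : ℝ) (u : X) :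
    ‖C t u‖ ≤ K * ‖u‖ :=
  (C t).le_of_opNorm_le (hCK t) u

theorem norm_sine_le (hCK : ∀ t : ℝ, ‖C t‖ ≤ K) (t : ℝ) (u : X) :
    ‖sine C t u‖ ≤ K * ‖u‖ * |t| := by
  simpa [sine] using intervalIntegral.norm_integral_le_of_norm_le_const (a := 0) (b := t)
    fun s _ => norm_apply_le_of_opNorm_le hCK s u

theorem IsCosineFamily.continuous_sine (hC : IsCosineFamily C) (u : X) :
    Continuous fun t => sine C t u :=
  intervalIntegral.continuous_primitive (fun a b => (hC.continuous u).intervalIntegrable a b) 0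

theorem norm_wrightM_smul_le (hK : 0 ≤ K) (hCK : ∀ t : ℝ, ‖C t‖ ≤ K) (q r θ : ℝ) (u : X) :
    ‖wrightM q θ • C (r * θ) u‖ ≤ K * ‖u‖ * ((1 + θ ^ 2) * |wrightM q θ|) := by
  rw [norm_smul, Real.norm_eq_abs]
  calc _ ≤ |wrightM q θ| * (K * ‖u‖) := by
        gcongr; exact norm_apply_le_of_opNorm_le hCK _ u
    _ ≤ (1 + θ ^ 2) * |wrightM q θ| * (K * ‖u‖) := by
        gcongr
        nlinarith [mul_nonneg (sq_nonneg θ) (abs_nonneg (wrightM q θ))]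
    _ = _ := by ring

/-- One factor `θ` comes from the kernel and one from the linear growth of the sine family, hence
the need for a second moment. The cap `R` makes the bound uniform in `r`. -/
theorem norm_mul_wrightM_smul_sine_le (hK : 0 ≤ K) (hCK : ∀ t : ℝ, ‖C t‖ ≤ K) {q r R θ : ℝ}
    (hq : 0 ≤ q) (hr : 0 ≤ r) (hrR : r ≤ R) (hθ : 0 < θ) (u : X) :
    ‖(q * θ * wrightM q θ) • sine C (r * θ) u‖ ≤
      q * K * ‖u‖ * R * ((1 + θ ^ 2) * |wrightM q θ|) := by
  rw [norm_smul, Real.norm_eq_abs, abs_mul, abs_of_nonneg (mul_nonneg hq hθ.le)]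
  have h := norm_sine_le hCK (r * θ) u
  rw [abs_of_nonneg (mul_nonneg hr hθ.le)] at h
  calc _ ≤ q * θ * |wrightM q θ| * (K * ‖u‖ * (r * θ)) := by gcongr
    _ = q * K * ‖u‖ * r * (θ ^ 2 * |wrightM q θ|) := by ring
    _ ≤ q * K * ‖u‖ * R * ((1 + θ ^ 2) * |wrightM q θ|) := by
        have hR : 0 ≤ R := hr.trans hrR
        gcongr
        linarith

theorem integrableOn_cosIntegrand (hC : IsCosineFamily C) (hK : 0 ≤ K) (hCK : ∀ t : ℝ, ‖C t‖ ≤ K)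
    {q : ℝ} (hq0 : 1 / 2 < q) (hq1 : q ≤ 1) (ψ : ℝ → ℝ) (t : ℝ) (u : X) :
    IntegrableOn (cosIntegrand C ψ q t u) (Ioi 0) :=
  integrableOn_smul_comp_mul (G := fun x => C x u) (measurable_wrightM hq0 hq1) (hC.continuous u)
    ((integrableOn_one_add_sq_mul_abs_wrightM hq0 hq1).const_mul (K * ‖u‖))
    fun θ _ => norm_wrightM_smul_le hK hCK q _ θ u

theorem continuousOn_opC (hC : IsCosineFamily C) (hK : 0 ≤ K) (hCK : ∀ t : ℝ, ‖C t‖ ≤ K)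
    {q : ℝ} (hq0 : 1 / 2 < q) (hq1 : q ≤ 1) {ψ : ℝ → ℝ} {S : Set ℝ} (hψ : ContinuousOn ψ S)
    (u : X) : ContinuousOn (fun t => opC C ψ q t u) S := by
  have h := continuousOn_integral_smul_comp_mul (S := univ) (G := fun x => C x u)
    (measurable_wrightM hq0 hq1) (hC.continuous u)
    ((integrableOn_one_add_sq_mul_abs_wrightM hq0 hq1).const_mul (K * ‖u‖))
    fun r _ θ _ => norm_wrightM_smul_le hK hCK q r θ u
  have h' := h.comp (s := S) (f := fun t => (ψ t - ψ 0) ^ q)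
    ((hψ.sub continuousOn_const).rpow_const fun _ _ => Or.inr (by linarith)) (mapsTo_univ _ _)
  exact h'

theorem continuousOn_resIntegrand (hC : IsCosineFamily C) (hK : 0 ≤ K) (hCK : ∀ t : ℝ, ‖C t‖ ≤ K)
    {q : ℝ} (hq0 : 1 / 2 < q) (hq1 : q ≤ 1) {ψ : ℝ → ℝ} {T : ℝ} (hT : 0 < T)
    (hψ : ContDiffOn ℝ 1 ψ (Icc 0 T)) (u : X) :
    ContinuousOn (resIntegrand C ψ T q u) (Icc 0 T) :=
  ((hψ.continuousOn_derivWithin (uniqueDiffOn_Icc hT) le_rfl).div_const _).smul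
    (continuousOn_opC hC hK hCK hq0 hq1 hψ.continuousOn u)

theorem integrableOn_sinIntegrand (hC : IsCosineFamily C) (hK : 0 ≤ K) (hCK : ∀ t : ℝ, ‖C t‖ ≤ K)
    {q : ℝ} (hq0 : 1 / 2 < q) (hq1 : q ≤ 1) {ψ : ℝ → ℝ} {s t : ℝ} (hst : ψ s ≤ ψ t) (u : X) :
    IntegrableOn (sinIntegrand C ψ q t s u) (Ioi 0) :=
  integrableOn_smul_comp_mul (m := fun θ => q * θ * wrightM q θ) (G := fun x => sine C x u)
    ((measurable_id.const_mul q).mul (measurable_wrightM hq0 hq1)) (hC.continuous_sine u)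
    ((integrableOn_one_add_sq_mul_abs_wrightM hq0 hq1).const_mul _)
    fun _ hθ => norm_mul_wrightM_smul_sine_le hK hCK (by linarith)
      (rpow_nonneg (sub_nonneg.2 hst) q) le_rfl hθ u

/-- `P_q(t, s)` depends on `(t, s)` only through `x = ψ(t) - ψ(s)`, so continuity in this one
variable gives estimates uniform in `s`. -/
theorem continuousOn_integral_mul_wrightM_smul_sine (hC : IsCosineFamily C) (hK : 0 ≤ K)
    (hCK : ∀ t : ℝ, ‖C t‖ ≤ K) {q : ℝ} (hq0 : 1 / 2 < q) (hq1 : q ≤ 1) (D : ℝ) (u : X) :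
    ContinuousOn (fun x : ℝ => ∫ θ in Ioi (0 : ℝ), (q * θ * wrightM q θ) • sine C (x ^ q * θ) u)
      (Icc 0 D) := by
  have h := continuousOn_integral_smul_comp_mul (S := Icc 0 (D ^ q))
    (m := fun θ => q * θ * wrightM q θ) (G := fun x => sine C x u)
    ((measurable_id.const_mul q).mul (measurable_wrightM hq0 hq1)) (hC.continuous_sine u)
    ((integrableOn_one_add_sq_mul_abs_wrightM hq0 hq1).const_mul _)
    fun r hr θ hθ => norm_mul_wrightM_smul_sine_le hK hCK (by linarith) hr.1 hr.2 hθ u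
  refine h.comp (continuousOn_id.rpow_const fun _ _ => Or.inr (by linarith)) fun x hx => ?_
  exact ⟨rpow_nonneg hx.1 q, rpow_le_rpow hx.1 hx.2 (by linarith)⟩

end

end PsiFractional

end

/-! ### The theorem -/

theorem proposition3p2 {X : Type*} [NormedAddCommGroup X] [NormedSpace ℝ X] [CompleteSpace X]
    (C : ℝ → X →L[ℝ] X) (hC : PsiFractional.IsCosineFamily C)
    (K : ℝ) (hK : 1 ≤ K) (hCK : ∀ t : ℝ, ‖C t‖ ≤ K)
    (T : ℝ) (hT : 0 < T)
    (ψ : ℝ → ℝ) (hψmono : StrictMonoOn ψ (Set.Icc 0 T)) (hψ : ContDiffOn ℝ 1 ψ (Set.Icc 0 T))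
    (hψ0 : derivWithin ψ (Set.Icc 0 T) 0 ≠ 0)
    (α q : ℝ) (hα1 : 1 < α) (hα2 : α ≤ 2) (hq : q = α / 2) :
    -- the series and the integrals that define the operators converge (absolutely)
    ((∀ z : ℝ, 0 ≤ z → Summable (PsiFractional.wrightTerm q z)) ∧
      (∀ u : X, ∀ t ∈ Set.Icc 0 T,
        MeasureTheory.IntegrableOn (PsiFractional.cosIntegrand C ψ q t u) (Set.Ioi 0)) ∧
      (∀ u : X, ∀ t ∈ Set.Icc 0 T,
        IntervalIntegrable (PsiFractional.resIntegrand C ψ T q u) MeasureTheory.volume 0 t) ∧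
      (∀ u : X, ∀ s t : ℝ, 0 ≤ s → s ≤ t → t ≤ T →
        MeasureTheory.IntegrableOn (PsiFractional.sinIntegrand C ψ q t s u) (Set.Ioi 0))) ∧
    -- the three operators are strongly continuous
    (∀ u : X, ∀ ε : ℝ, 0 < ε → ∃ δ : ℝ, 0 < δ ∧ ∀ t₁ t₂ : ℝ,
      0 ≤ t₁ → t₁ ≤ t₂ → t₂ ≤ T → t₂ - t₁ < δ →
        ‖PsiFractional.opC C ψ q t₂ u - PsiFractional.opC C ψ q t₁ u‖ < ε) ∧
    (∀ u : X, ∀ ε : ℝ, 0 < ε → ∃ δ : ℝ, 0 < δ ∧ ∀ t₁ t₂ : ℝ,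
      0 ≤ t₁ → t₁ ≤ t₂ → t₂ ≤ T → t₂ - t₁ < δ →
        ‖PsiFractional.opR C ψ T q t₂ u - PsiFractional.opR C ψ T q t₁ u‖ < ε) ∧
    (∀ u : X, ∀ ε : ℝ, 0 < ε → ∃ δ : ℝ, 0 < δ ∧ ∀ s t₁ t₂ : ℝ,
      0 ≤ s → s ≤ t₁ → t₁ ≤ t₂ → t₂ ≤ T → t₂ - t₁ < δ →
        ‖PsiFractional.opP C ψ q t₂ s u - PsiFractional.opP C ψ q t₁ s u‖ < ε) := by
  have hq0 : 1 / 2 < q := by linarith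
  have hq1 : q ≤ 1 := by linarith
  have hK0 : 0 ≤ K := by linarith
  have hψc := hψ.continuousOn
  have hres (u : X) := PsiFractional.continuousOn_resIntegrand hC hK0 hCK hq0 hq1 hT hψ u
  refine ⟨⟨fun z _ => PsiFractional.summable_wrightTerm hq0 hq1 z,
    fun u t _ => PsiFractional.integrableOn_cosIntegrand hC hK0 hCK hq0 hq1 ψ t u,
    fun u t ht => ?_, fun u s t hs hst ht => ?_⟩, fun u ε hε => ?_, fun u ε hε => ?_,
    fun u ε hε => ?_⟩
  · exact ((hres u).mono (Set.Icc_subset_Icc_right ht.2)).intervalIntegrable_of_Icc ht.1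
  · exact PsiFractional.integrableOn_sinIntegrand hC hK0 hCK hq0 hq1
      (hψmono.monotoneOn ⟨hs, hst.trans ht⟩ ⟨hs.trans hst, ht⟩ hst) u
  · obtain ⟨δ, hδ, h⟩ := PsiFractional.exists_delta_of_continuousOn_Icc
      (PsiFractional.continuousOn_opC hC hK0 hCK hq0 hq1 hψc u) hε
    exact ⟨δ, hδ, fun t₁ t₂ h0 h12 h2 hd => h t₁ ⟨h0, h12.trans h2⟩ t₂ ⟨h0.trans h12, h2⟩
      (by rwa [abs_of_nonneg (sub_nonneg.2 h12)])⟩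
  · have hcont : ContinuousOn (fun t => PsiFractional.opR C ψ T q t u) (Set.Icc 0 T) := by
      have hi := (hres u).integrableOn_Icc (μ := MeasureTheory.volume)
      rw [← Set.uIcc_of_le hT.le] at hi ⊢
      exact intervalIntegral.continuousOn_primitive_interval hi
    obtain ⟨δ, hδ, h⟩ := PsiFractional.exists_delta_of_continuousOn_Icc hcont hε
    exact ⟨δ, hδ, fun t₁ t₂ h0 h12 h2 hd => h t₁ ⟨h0, h12.trans h2⟩ t₂ ⟨h0.trans h12, h2⟩
      (by rwa [abs_of_nonneg (sub_nonneg.2 h12)])⟩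
  -- By monotonicity all increments `ψ t - ψ s` lie in `[0, ψ T - ψ 0]`, and `ψ s` cancels in their
  -- difference, so `δ` is independent of `s`.
  · obtain ⟨η, hη, h⟩ := PsiFractional.exists_delta_of_continuousOn_Icc
      (PsiFractional.continuousOn_integral_mul_wrightM_smul_sine hC hK0 hCK hq0 hq1
        (ψ T - ψ 0) u) hε
    obtain ⟨δ, hδ, hψδ⟩ := PsiFractional.exists_delta_of_continuousOn_Icc hψc hη
    refine ⟨δ, hδ, fun s t₁ t₂ h0 hs1 h12 h2 hd => ?_⟩
    have hm := hψmono.monotoneOn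
    have m0 : (0 : ℝ) ∈ Set.Icc 0 T := ⟨le_rfl, hT.le⟩
    have mT : T ∈ Set.Icc 0 T := ⟨hT.le, le_rfl⟩
    have ms : s ∈ Set.Icc 0 T := ⟨h0, by linarith⟩
    have m1 : t₁ ∈ Set.Icc 0 T := ⟨by linarith, by linarith⟩
    have m2 : t₂ ∈ Set.Icc 0 T := ⟨by linarith, h2⟩
    have e0 := hm m0 ms h0
    have e1 := hm ms m1 hs1
    have e2 := hm m1 m2 h12
    have e3 := hm m2 mT h2
    refine h (ψ t₁ - ψ s) ⟨by linarith, by linarith⟩ (ψ t₂ - ψ s) ⟨by linarith, by linarith⟩ ?_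
    rw [sub_sub_sub_cancel_right]
    exact hψδ t₁ m1 t₂ m2 (by rwa [abs_of_nonneg (sub_nonneg.2 h12)])
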